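/- Let $V:\mathbb R\to\mathbb R$ be a smooth ($C^\infty$), $1$-periodic potential, put $\overline E:=\max V$, and assume that $V$ attains its maximum at a unique point $x_0\in[0,1)$ and that $\int_0^1(\overline E-V)^{-1/2}\,dx=\infty$. Define the critical gauge $$\underline P:=\int_0^1\sqrt{\overline E-V(x)}\,dx .$$ For $h>0$ and $P\in\mathbb R$ let $L_{h,P}\psi:=-\left(h\frac{d}{dx}+iP\right)^2\psi+V\psi$ act on $1$-periodic functions $\psi:\mathbb R\to\mathbb C$ (functions on the circle). A normalized Bloch eigenstate of $L_{h,P}$ with eigenvalue $E$ is a $1$-periodic $C^2$ function $\psi$ with $L_{h,P}\psi=E\psi$ and $\int_0^1|\psi|^2\,dx=1$ that can be written $\psi=Ae^{i\theta}$, where $A>0$ and $\theta$ are continuous, real-valued and $1$-periodic (in particular $\theta(0)=\theta(1)$). Then there exist sequences $P_k\searrow\underline P$ and $E_k\searrow\overline E$ (strictly decreasing), $h_k>0$ with $h_k\to0$, and normalized Bloch eigenstates $\psi_k$ of $L_{h_k,P_k}$ with eigenvalue $E_k$, such that $|\psi_k|^2\to\delta_{x_0}$ in the sense of distributions on the circle: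 for every smooth $1$-periodic $f:\mathbb R\to\mathbb R$, $$\int_0^1 f\,|\psi_k|^2\,dx\;\longrightarrow\; f(x_0)\qquad(k\to\infty).$$ -/

import Mathlib

open Real Set Filter Topology MeasureTheory
open scoped ContDiff

noncomputable section

/-- The first order operator `h d/dx + i P`. -/
def gaugeDeriv (h P : ℝ) (ψ : ℝ → ℂ) : ℝ → ℂ :=
  fun x => (h : ℂ) * deriv ψ x + Complex.I * (P : ℂ) * ψ x

/-- The Schroedinger operator `L ψ = -(h d/dx + i P)^2 ψ + V ψ` with constant gauge `P`.
Functions on the circle of length one are represented by `1`-periodic functions on the line. -/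
def gaugeSchrodinger (V : ℝ → ℝ) (h P : ℝ) (ψ : ℝ → ℂ) : ℝ → ℂ :=
  fun x => -(gaugeDeriv h P (gaugeDeriv h P ψ) x) + (V x : ℂ) * ψ x

/-- `ψ` is a (classical) eigenfunction of the Schroedinger operator on the circle with
eigenvalue `E`. -/
structure IsEigenstate (V : ℝ → ℝ) (h P E : ℝ) (ψ : ℝ → ℂ) : Prop where
  contDiff : ContDiff ℝ 2 ψ
  periodic : Function.Periodic ψ 1
  nonzero : ψ ≠ 0
  eigen : ∀ x, gaugeSchrodinger V h P ψ x = (E : ℂ) * ψ x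

/-- `ψ = A e^{iθ}` with a strictly positive amplitude `A` and a phase `θ` that is a continuous
real-valued function on the circle (so the phase has no winding). -/
def HasBlochForm (ψ : ℝ → ℂ) : Prop :=
  ∃ A θ : ℝ → ℝ, Continuous A ∧ Continuous θ ∧ Function.Periodic A 1 ∧ Function.Periodic θ 1 ∧
    (∀ x, 0 < A x) ∧ ∀ x, ψ x = (A x : ℂ) * Complex.exp (Complex.I * (θ x : ℂ))

/-- `ψ` is a normalized Bloch eigenstate with eigenvalue `E`. -/
structure IsNormalizedBlochEigenstate (V : ℝ → ℝ) (h P E : ℝ) (ψ : ℝ → ℂ) : Prop where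
  eigenstate : IsEigenstate V h P E ψ
  bloch : HasBlochForm ψ
  normalized : ∫ x in (0 : ℝ)..1, ‖ψ x‖ ^ 2 = 1

/-- The maximum of the potential (a maximum whenever `V` is continuous and periodic). -/
def potentialMax (V : ℝ → ℝ) : ℝ := ⨆ x, V x

/-- The critical gauge `∫₀¹ √(max V - V)`. -/
def criticalGauge (V : ℝ → ℝ) : ℝ := ∫ x in (0 : ℝ)..1, √(potentialMax V - V x)

/-- `u` decreases strictly to the limit `a`. -/
def DecreasesTo (u : ℕ → ℝ) (a : ℝ) : Prop := StrictAnti u ∧ Tendsto u atTop (𝓝 a)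

/-- The densities `ρ k` on the circle converge to the Dirac mass at `x₀` in the sense of
distributions on the circle. -/
def TendstoDirac (ρ : ℕ → ℝ → ℝ) (x₀ : ℝ) : Prop :=
  ∀ f : ℝ → ℝ, ContDiff ℝ ∞ f → Function.Periodic f 1 →
    Tendsto (fun k => ∫ x in (0 : ℝ)..1, f x * ρ k x) atTop (𝓝 (f x₀))

end

/-! If `(h d/dx + iP)ψ = pψ`, the eigenvalue equation becomes the Riccati equation `h p' + p² + E -
V = 0`. A periodic solution with positive imaginary part `y` returns a Bloch state: `|ψ|²` is
proportional to `1/y`, and the phase is periodic exactly when `P` is the mean of `y`. So `E` and `h`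
are chosen first and `P` is read off.

For fixed `E > max V`, put `q = √(E - V) > 0`. A WKB ansatz `p ≈ iq` leaves a small residual, and
the correction solves a linear equation with fast phase `2q/h` plus a quadratic term. At values of
`h` making the integrating factor antiperiodic, the linear operator is invertible on the circle with
a bound independent of `h`, so a contraction gives an exact solution with `y = q + O(h)`
(`exists_periodic_riccati`). These `h` accumulate at `0`, so `P` can be made as close as desired to
`∫ q`, with `|ψ|²` at most twice the normalized classical density `q⁻¹ / ∫ q⁻¹`
(`exists_semiclassical_blochEigenstate`).

As `E` decreases to `max V`, Fatou makes `∫ q⁻¹` blow up while `∫ q` stays bounded. Since `|f - f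
x₀| ≤ ε + C q²`, the error is at most `ε + 2C ∫ q / ∫ q⁻¹`, which forces concentration at `x₀`. -/

/-! ### From the Riccati equation to Bloch states -/

/-- A periodic solution `p` of the Riccati equation `h p' + p² + (E - V) = 0` with positive
imaginary part yields a normalized Bloch eigenstate. -/
theorem exists_blochEigenstate_of_riccati {V : ℝ → ℝ} {h E : ℝ} (hh : 0 < h) {p : ℝ → ℂ}
    (hV : Continuous V) (hp : Function.Periodic p 1) (hpos : ∀ x, 0 < (p x).im)
    (hric : ∀ x, HasDerivAt p (-(p x ^ 2 + (E - V x : ℝ)) / h) x) :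
    ∃ ψ, IsNormalizedBlochEigenstate V h (∫ x in (0 : ℝ)..1, (p x).im) E ψ ∧
      ∀ x, ‖ψ x‖ ^ 2 = ((p x).im)⁻¹ / ∫ t in (0 : ℝ)..1, ((p t).im)⁻¹ := by
  have hpc : Continuous p := continuous_iff_continuousAt.2 fun x => (hric x).continuousAt
  have hyc : Continuous fun x => (p x).im := Complex.continuous_im.comp hpc
  have hyp : Function.Periodic (fun x => (p x).im) 1 := fun x => by simp only [hp x]
  set P : ℝ := ∫ x in (0 : ℝ)..1, (p x).im with hP
  set Z : ℝ := ∫ t in (0 : ℝ)..1, ((p t).im)⁻¹ with hZ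
  have hic : Continuous fun x => ((p x).im)⁻¹ := hyc.inv₀ fun x => (hpos x).ne'
  have hZpos : 0 < Z := by
    refine intervalIntegral.intervalIntegral_pos_of_pos (hic.intervalIntegrable _ _)
      (fun x => inv_pos.2 (hpos x)) one_pos
  set A : ℝ → ℝ := fun x => √(((p x).im)⁻¹ / Z) with hA
  set θ : ℝ → ℝ := fun x => ((∫ t in (0 : ℝ)..x, (p t).im) - P * x) / h with hθ
  have hAarg : ∀ x, 0 < ((p x).im)⁻¹ / Z := fun x => div_pos (inv_pos.2 (hpos x)) hZpos
  have hApos : ∀ x, 0 < A x := fun x => sqrt_pos.2 (hAarg x)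
  have hAsq : ∀ x, A x ^ 2 = ((p x).im)⁻¹ / Z := fun x => sq_sqrt (hAarg x).le
  have hAc : Continuous A := (hic.div_const Z).sqrt
  -- The imaginary part of the Riccati equation is `h y' = -2 (Re p) y`, so `y^(-1/2)` has
  -- logarithmic derivative `Re p / h`, as the amplitude must.
  have hyd : ∀ x, HasDerivAt (fun x => (p x).im) (-(2 * (p x).re * (p x).im) / h) x := by
    intro x
    have := (Complex.imCLM.hasFDerivAt.comp_hasDerivAt x (hric x))
    refine this.congr_deriv ?_
    simp only [Complex.imCLM_apply, Complex.div_ofReal_im, Complex.neg_im, Complex.add_im,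
      Complex.ofReal_im, pow_two, Complex.mul_im]
    ring
  have hAd : ∀ x, HasDerivAt A (A x * ((p x).re / h)) x := by
    intro x
    have h1 := (((hyd x).inv (hpos x).ne').div_const Z).sqrt (hAarg x).ne'
    refine h1.congr_deriv ?_
    have h2 : √(((p x).im)⁻¹ / Z) = A x := rfl
    simp only [Pi.inv_apply]
    rw [h2, div_eq_iff (by have := hApos x; positivity)]
    have h3 : A x * ((p x).re / h) * (2 * A x) = A x ^ 2 * (2 * ((p x).re / h)) := by ring
    rw [h3, hAsq]
    have := (hpos x).ne'
    field_simp
  have hθd : ∀ x, HasDerivAt θ (((p x).im - P) / h) x := by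
    intro x
    have h1 := intervalIntegral.integral_hasDerivAt_right (hyc.intervalIntegrable 0 x)
      hyc.stronglyMeasurable.stronglyMeasurableAtFilter hyc.continuousAt
    have h2 := (h1.sub ((hasDerivAt_id x).const_mul P)).div_const h
    simpa using h2
  have hθc : Continuous θ := continuous_iff_continuousAt.2 fun x => (hθd x).continuousAt
  have hθp : Function.Periodic θ 1 := by
    intro x
    have h1 : (∫ t in (0 : ℝ)..(x + 1), (p t).im) = (∫ t in (0 : ℝ)..x, (p t).im) + P := by
      rw [← intervalIntegral.integral_add_adjacent_intervals (hyc.intervalIntegrable 0 x)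
        (hyc.intervalIntegrable x (x + 1)), hyp.intervalIntegral_add_eq x 0, zero_add]
    simp only [hθ, h1]
    ring
  have hAp : Function.Periodic A 1 := fun x => by simp only [hA, hp x]
  set ψ : ℝ → ℂ := fun x => (A x : ℂ) * Complex.exp (Complex.I * (θ x : ℂ)) with hψ
  have hψn : ∀ x, ‖ψ x‖ ^ 2 = ((p x).im)⁻¹ / Z := by
    intro x
    simp only [hψ, norm_mul, Complex.norm_real, mul_comm Complex.I, Complex.norm_exp_ofReal_mul_I,
      mul_one, norm_eq_abs, sq_abs, hAsq]
  have hhc : (h : ℂ) ≠ 0 := by exact_mod_cast hh.ne'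
  have hψd : ∀ x, HasDerivAt ψ (ψ x * ((p x - Complex.I * P) / h)) x := by
    intro x
    have h1 := (hAd x).ofReal_comp.mul (((hθd x).ofReal_comp.const_mul Complex.I).cexp)
    refine h1.congr_deriv ?_
    simp only [hψ]
    have : p x = (p x).re + (p x).im * Complex.I := (Complex.re_add_im _).symm
    generalize (p x).re = r at *
    generalize (p x).im = s at *
    rw [this]
    push_cast
    field_simp
    ring
  have hψc : Continuous ψ := continuous_iff_continuousAt.2 fun x => (hψd x).continuousAt
  have hψd' : deriv ψ = fun x => ψ x * ((p x - Complex.I * P) / h) := funext fun x => (hψd x).deriv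
  have hψ1 : ContDiff ℝ 1 ψ := by
    rw [contDiff_one_iff_deriv]
    refine ⟨fun x => (hψd x).differentiableAt, ?_⟩
    rw [hψd']
    fun_prop
  have hp1 : ContDiff ℝ 1 p := by
    rw [contDiff_one_iff_deriv]
    refine ⟨fun x => (hric x).differentiableAt, ?_⟩
    rw [funext fun x => (hric x).deriv]
    fun_prop
  have hg : gaugeDeriv h P ψ = fun x => p x * ψ x := by
    funext x
    simp only [gaugeDeriv, (hψd x).deriv]
    field_simp
    ring
  refine ⟨ψ, ⟨⟨?_, ?_, ?_, ?_⟩, ⟨A, θ, hAc, hθc, hAp, hθp, hApos, fun x => rfl⟩, ?_⟩, hψn⟩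
  · have : (2 : WithTop ℕ∞) = 1 + 1 := by norm_num
    rw [this, contDiff_succ_iff_deriv]
    refine ⟨fun x => (hψd x).differentiableAt, by simp, ?_⟩
    rw [hψd']
    exact hψ1.mul ((hp1.sub contDiff_const).div_const _)
  · intro x
    simp only [hψ, hAp x, hθp x]
  · intro h0
    have := hψn 0
    rw [h0] at this
    have h2 := hAarg 0
    rw [← this] at h2
    simp at h2
  · intro x
    have h1 : deriv (fun x => p x * ψ x) x = _ := ((hric x).mul (hψd x)).deriv
    simp only [gaugeSchrodinger, hg]
    simp only [gaugeDeriv, h1]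
    push_cast
    field_simp
    ring
  · simp only [hψn]
    rw [intervalIntegral.integral_div, div_self hZpos.ne']

/-! ### Contraction for the quadratic correction -/

/-- Small fixed points of `w ↦ K (-(h G + (h s + w)²))`, uniformly over additive maps `K` with a
given bound. -/
theorem exists_small_fixedPoint {X : Type*} [NormedCommRing X] [NormedAlgebra ℝ X]
    [CompleteSpace X] (C : ℝ) (hC : 0 ≤ C) (G s : X) :
    ∃ D h₀ : ℝ, 0 < D ∧ 0 < h₀ ∧ ∀ h, 0 < h → h < h₀ → ∀ K : X →+ X, (∀ g, ‖K g‖ ≤ C * ‖g‖) →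
      ∃ w, ‖w‖ ≤ D * h ∧ K (-(h • G + (h • s + w) ^ 2)) = w := by
  set D : ℝ := C * ‖G‖ + 1 with hD
  set M : ℝ := ‖s‖ + D with hM
  have hD1 : 1 ≤ D := by have := norm_nonneg G; rw [hD]; nlinarith [mul_nonneg hC this]
  have hM1 : 1 ≤ M := by have := norm_nonneg s; rw [hM]; linarith
  -- On the ball of radius `D h` the squared term is at most `h² M²`, so the ball is preserved once
  -- `C h M² ≤ 1/4`; the Lipschitz constant is then `2 C h M ≤ 1/2`, because `M ≥ 1`. Using `C + 1`
  -- avoids dividing by zero.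
  refine ⟨D, 1 / (4 * (C + 1) * M ^ 2), by linarith, by positivity, ?_⟩
  intro h hh hh0 K hK
  have hsmall : C * h * M ^ 2 ≤ 1 / 4 := by
    rw [lt_div_iff₀ (by positivity)] at hh0
    nlinarith [mul_pos hh (pow_pos (by linarith : 0 < M) 2)]
  have hsmall' : C * h * M ≤ 1 / 4 := by
    refine le_trans ?_ hsmall
    exact mul_le_mul_of_nonneg_left (by nlinarith) (by positivity)
  set T : X → X := fun w => K (-(h • G + (h • s + w) ^ 2)) with hT
  set B : Set X := Metric.closedBall 0 (D * h) with hB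
  have hsn : ‖h • s‖ = h * ‖s‖ := by rw [norm_smul, norm_eq_abs, abs_of_pos hh]
  have hGn : ‖h • G‖ = h * ‖G‖ := by rw [norm_smul, norm_eq_abs, abs_of_pos hh]
  have hball : ∀ w ∈ B, ‖h • s + w‖ ≤ h * M := by
    intro w hw
    rw [hB, mem_closedBall_zero_iff] at hw
    calc ‖h • s + w‖ ≤ ‖h • s‖ + ‖w‖ := norm_add_le _ _
      _ ≤ h * M := by rw [hsn, hM]; linarith
  have hmaps : MapsTo T B B := by
    intro w hw
    have h1 := hball w hw
    rw [hB, mem_closedBall_zero_iff]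
    calc ‖T w‖ ≤ C * ‖-(h • G + (h • s + w) ^ 2)‖ := hK _
      _ ≤ C * (h * ‖G‖ + (h * M) ^ 2) := by
        refine mul_le_mul_of_nonneg_left ?_ hC
        rw [norm_neg]
        refine (norm_add_le _ _).trans ?_
        rw [hGn, pow_two, pow_two]
        have : ‖(h • s + w) * (h • s + w)‖ ≤ (h * M) * (h * M) :=
          (norm_mul_le _ _).trans (mul_le_mul h1 h1 (norm_nonneg _) (by positivity))
        linarith
      _ ≤ D * h := by rw [hD]; nlinarith
  have hlip : LipschitzOnWith (1 / 2) T B := by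
    refine LipschitzOnWith.of_dist_le_mul fun u hu v hv => ?_
    have h1 := hball u hu
    have h2 := hball v hv
    rw [dist_eq_norm, dist_eq_norm, hT]
    simp only [← map_sub]
    have e : -(h • G + (h • s + u) ^ 2) - -(h • G + (h • s + v) ^ 2)
        = -((h • s + u) + (h • s + v)) * (u - v) := by ring
    rw [e]
    have h3 : ‖-((h • s + u) + (h • s + v)) * (u - v)‖ ≤ (h * M + h * M) * ‖u - v‖ := by
      refine (norm_mul_le _ _).trans (mul_le_mul_of_nonneg_right ?_ (norm_nonneg _))
      rw [norm_neg]
      exact (norm_add_le _ _).trans (add_le_add h1 h2)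
    refine (hK _).trans ((mul_le_mul_of_nonneg_left h3 hC).trans ?_)
    have : ((1 / 2 : NNReal) : ℝ) = 1 / 2 := by simp
    rw [this, ← mul_assoc]
    exact mul_le_mul_of_nonneg_right (by nlinarith) (norm_nonneg _)
  have hcomplete : IsComplete B := Metric.isClosed_closedBall.isComplete
  have hcontr : ContractingWith (1 / 2) (hmaps.restrict T B B) :=
    ⟨by rw [← NNReal.coe_lt_coe]; norm_num, hlip.mapsToRestrict hmaps⟩
  obtain ⟨w, hwB, hw, -⟩ := ContractingWith.exists_fixedPoint' hcomplete hmaps hcontr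
    (x := 0) (by rw [hB]; exact Metric.mem_closedBall_self (by positivity)) (edist_ne_top _ _)
  exact ⟨w, mem_closedBall_zero_iff.1 hwB, hw⟩

/-! ### Inverting the linearized equation on the circle -/

/-- The solution operator of `z' + a z = g` on the circle, where `m` is an antiperiodic
integrating factor (`m' = a m`). -/
noncomputable def antiperiodicSolve (m g : ℝ → ℂ) (x : ℝ) : ℂ :=
  (m x)⁻¹ * ((∫ t in (0 : ℝ)..x, m t * g t) - (1 / 2) * ∫ t in (0 : ℝ)..1, m t * g t)

theorem antiperiodicSolve_hasDerivAt {m a g : ℝ → ℂ} (hm0 : ∀ x, m x ≠ 0)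
    (hm : ∀ x, HasDerivAt m (a x * m x) x) (hg : Continuous g) (x : ℝ) :
    HasDerivAt (antiperiodicSolve m g) (g x - a x * antiperiodicSolve m g x) x := by
  have hmc : Continuous m := continuous_iff_continuousAt.2 fun x => (hm x).continuousAt
  have hc : Continuous fun t => m t * g t := hmc.mul hg
  have h1 := intervalIntegral.integral_hasDerivAt_right (hc.intervalIntegrable 0 x)
    hc.stronglyMeasurable.stronglyMeasurableAtFilter hc.continuousAt
  have h2 := ((hm x).inv (hm0 x)).mul
    (h1.sub_const ((1 / 2) * ∫ t in (0 : ℝ)..1, m t * g t))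
  refine h2.congr_deriv ?_
  have := hm0 x
  simp only [antiperiodicSolve, Pi.inv_apply]
  field_simp
  ring

/-- With `I` the integral over a period, a shift by one turns `∫₀ˣ + c` into `I - ∫₀ˣ + c`, while
`m⁻¹` changes sign. Periodicity therefore forces `c = -I/2`, the constant in `antiperiodicSolve`. -/
theorem antiperiodicSolve_periodic {m g : ℝ → ℂ} (hmc : Continuous m)
    (hm : Function.Antiperiodic m 1) (hg : Continuous g) (hgp : Function.Periodic g 1) :
    Function.Periodic (antiperiodicSolve m g) 1 := by
  intro x
  have hc : Continuous fun t => m t * g t := hmc.mul hg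
  have h1 : (∫ t in (0 : ℝ)..(x + 1), m t * g t)
      = (∫ t in (0 : ℝ)..1, m t * g t) - ∫ t in (0 : ℝ)..x, m t * g t := by
    rw [← intervalIntegral.integral_add_adjacent_intervals (hc.intervalIntegrable 0 1)
      (hc.intervalIntegrable 1 (x + 1)), sub_eq_add_neg, ← intervalIntegral.integral_neg]
    congr 1
    have := intervalIntegral.integral_comp_add_right (a := 0) (b := x) (fun t => m t * g t) 1
    rw [zero_add] at this
    rw [← this]
    refine intervalIntegral.integral_congr fun t _ => ?_
    simp only [hm t, hgp t, neg_mul]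
  simp only [antiperiodicSolve, h1, hm x, inv_neg]
  ring

/-- Only ratios of `|m|` enter, so an oscillating phase of any frequency costs nothing; this makes
the bound uniform in `h`. -/
theorem norm_antiperiodicSolve_le {m g : ℝ → ℂ} {C B : ℝ} (hB : 0 ≤ B)
    (hC : ∀ x y, ‖(m x)⁻¹‖ * ‖m y‖ ≤ C) (hg : ∀ x, ‖g x‖ ≤ B) {x : ℝ} (hx : x ∈ Icc (0 : ℝ) 1) :
    ‖antiperiodicSolve m g x‖ ≤ 2 * C * B := by
  have hC0 : 0 ≤ C := le_trans (by positivity) (hC 0 0)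
  have key : ∀ b ∈ Icc (0 : ℝ) 1, ‖(m x)⁻¹ * ∫ t in (0 : ℝ)..b, m t * g t‖ ≤ C * B := by
    intro b hb
    rw [← intervalIntegral.integral_const_mul]
    have h1 : ∀ t ∈ uIoc (0 : ℝ) b, ‖(m x)⁻¹ * (m t * g t)‖ ≤ C * B := by
      intro t _
      rw [norm_mul, norm_mul, ← mul_assoc]
      exact mul_le_mul (hC x t) (hg t) (norm_nonneg _) hC0
    refine (intervalIntegral.norm_integral_le_of_norm_le_const h1).trans ?_
    rw [sub_zero, abs_of_nonneg hb.1]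
    exact mul_le_of_le_one_right (by positivity) hb.2
  have e : antiperiodicSolve m g x = (m x)⁻¹ * (∫ t in (0 : ℝ)..x, m t * g t)
      - (1 / 2) * ((m x)⁻¹ * ∫ t in (0 : ℝ)..1, m t * g t) := by
    simp only [antiperiodicSolve]; ring
  rw [e]
  refine (norm_sub_le _ _).trans ?_
  have h1 := key x hx
  have h2 := key 1 (by simp)
  rw [norm_mul (1 / 2 : ℂ)]
  have h3 : ‖(1 / 2 : ℂ)‖ = 1 / 2 := by simp
  rw [h3]
  nlinarith [mul_nonneg hC0 hB]

/-- `antiperiodicSolve` as an additive map on continuous functions on the circle. -/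
noncomputable def circleSolve (m : ℝ → ℂ) (hmc : Continuous m) (hm : Function.Antiperiodic m 1)
    (hm0 : ∀ x, m x ≠ 0) : C(UnitAddCircle, ℂ) →+ C(UnitAddCircle, ℂ) where
  toFun g :=
    { toFun := (antiperiodicSolve_periodic hmc hm
        (g.continuous.comp (AddCircle.continuous_mk' 1))
        (fun x => by simp)).lift
      continuous_toFun := by
        refine continuous_coinduced_dom.2 ?_
        have hc : Continuous fun t : ℝ => m t * g t :=
          hmc.mul (g.continuous.comp (AddCircle.continuous_mk' 1))
        exact (hmc.inv₀ hm0).mul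
          ((intervalIntegral.continuous_primitive (fun a b => hc.intervalIntegrable a b) 0).sub
            continuous_const) }
  map_zero' := by
    ext x
    induction x using QuotientAddGroup.induction_on with
    | H x =>
      change antiperiodicSolve m (fun t : ℝ => (0 : C(UnitAddCircle, ℂ)) t) x = 0
      simp [antiperiodicSolve]
  map_add' g₁ g₂ := by
    ext x
    induction x using QuotientAddGroup.induction_on with
    | H x =>
      have hc : ∀ g : C(UnitAddCircle, ℂ), Continuous fun t : ℝ => m t * g t := fun g =>
        hmc.mul (g.continuous.comp (AddCircle.continuous_mk' 1))
      change antiperiodicSolve m (fun t : ℝ => (g₁ + g₂) t) x =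
        antiperiodicSolve m (fun t : ℝ => g₁ t) x + antiperiodicSolve m (fun t : ℝ => g₂ t) x
      simp only [antiperiodicSolve, ContinuousMap.add_apply, mul_add]
      rw [intervalIntegral.integral_add ((hc g₁).intervalIntegrable _ _)
        ((hc g₂).intervalIntegrable _ _), intervalIntegral.integral_add
        ((hc g₁).intervalIntegrable _ _) ((hc g₂).intervalIntegrable _ _)]
      ring

theorem circleSolve_apply_coe (m : ℝ → ℂ) (hmc : Continuous m) (hm : Function.Antiperiodic m 1)
    (hm0 : ∀ x, m x ≠ 0) (g : C(UnitAddCircle, ℂ)) (x : ℝ) :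
    circleSolve m hmc hm hm0 g x = antiperiodicSolve m (fun t : ℝ => g t) x := rfl

theorem norm_circleSolve_le {m : ℝ → ℂ} (hmc : Continuous m) (hm : Function.Antiperiodic m 1)
    (hm0 : ∀ x, m x ≠ 0) {C : ℝ} (hC : ∀ x y, ‖(m x)⁻¹‖ * ‖m y‖ ≤ C) (g : C(UnitAddCircle, ℂ)) :
    ‖circleSolve m hmc hm hm0 g‖ ≤ 2 * C * ‖g‖ := by
  have hC0 : 0 ≤ C := le_trans (by positivity) (hC 0 0)
  refine (ContinuousMap.norm_le _ (by positivity)).2 fun x => ?_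
  obtain ⟨y, hy, rfl⟩ : ∃ y ∈ Ico (0 : ℝ) (0 + 1), (y : UnitAddCircle) = x := by
    have := AddCircle.coe_image_Ico_eq (1 : ℝ) 0
    have hx : x ∈ ((↑) : ℝ → UnitAddCircle) '' Ico (0 : ℝ) (0 + 1) := by rw [this]; trivial
    exact hx
  rw [circleSolve_apply_coe]
  rw [zero_add] at hy
  exact norm_antiperiodicSolve_le (norm_nonneg g) hC (fun x => g.norm_coe_le_norm x)
    (Ico_subset_Icc_self hy)

/-! ### WKB solution of the Riccati equation -/

/-- Moves the WKB data into the Banach algebra of continuous functions on the circle, where the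
fixed point is found. -/
theorem exists_circle_lift {u : ℝ → ℂ} (hu : Continuous u) (hp : Function.Periodic u 1) :
    ∃ U : C(UnitAddCircle, ℂ), ∀ x : ℝ, U x = u x :=
  ⟨⟨hp.lift, continuous_coinduced_dom.2 hu⟩, fun _ => rfl⟩

theorem Function.Periodic.deriv_one {q : ℝ → ℝ} (hp : Function.Periodic q 1) :
    Function.Periodic (deriv q) 1 := fun x => by
  rw [← deriv_comp_add_const, show (fun x => q (x + 1)) = q from funext hp]

/-- A second order WKB ansatz can be corrected to an exact periodic solution of the Riccati
equation at nonresonant values of `h`. -/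
theorem exists_periodic_riccati {q : ℝ → ℝ} (hq : ContDiff ℝ ∞ q) (hqp : Function.Periodic q 1)
    (hq0 : ∀ x, 0 < q x) :
    ∃ M h₀ : ℝ, 0 < M ∧ 0 < h₀ ∧ ∀ h, 0 < h → h < h₀ →
      Complex.exp (((2 * (∫ x in (0 : ℝ)..1, q x) / h : ℝ) : ℂ) * Complex.I) = -1 →
      ∃ p : ℝ → ℂ, Function.Periodic p 1 ∧
        (∀ x, HasDerivAt p (-(p x ^ 2 + (q x ^ 2 : ℝ)) / h) x) ∧
        ∀ x, |(p x).im - q x| ≤ M * h := by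
  have hqc : Continuous q := hq.continuous
  have hqd : ∀ x, HasDerivAt q (deriv q x) x := fun x =>
    ((hq.differentiable (by simp)) x).hasDerivAt
  have hq' : ContDiff ℝ ∞ (deriv q) := (contDiff_infty_iff_deriv.1 hq).2
  -- In the ansatz `iq + h p₁ + h(h i s + w)`, `p₁` cancels the residual of order `h` and `s` that
  -- of order `h²`. What is left is a source `h i G` for `w`, small enough for the contraction;
  -- stopping at `p₁` would leave a source of order one.
  set p₁ : ℝ → ℝ := fun x => -deriv q x / (2 * q x) with hp₁
  have hp₁s : ContDiff ℝ ∞ p₁ :=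
    hq'.neg.div (contDiff_const.mul hq) fun x => by have := hq0 x; positivity
  have hp₁p : Function.Periodic p₁ 1 := fun x => by simp only [hp₁, hqp x, hqp.deriv_one x]
  have hp₁d : ∀ x, HasDerivAt p₁ (deriv p₁ x) x := fun x =>
    ((hp₁s.differentiable (by simp)) x).hasDerivAt
  set s : ℝ → ℝ := fun x => (deriv p₁ x + p₁ x ^ 2) / (2 * q x) with hs
  have hss : ContDiff ℝ ∞ s :=
    ((contDiff_infty_iff_deriv.1 hp₁s).2.add (hp₁s.pow 2)).div (contDiff_const.mul hq)
      fun x => by have := hq0 x; positivity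
  have hsp : Function.Periodic s 1 := fun x => by
    simp only [hs, hqp x, hp₁p x, hp₁p.deriv_one x]
  have hsd : ∀ x, HasDerivAt s (deriv s x) x := fun x =>
    ((hss.differentiable (by simp)) x).hasDerivAt
  set G : ℝ → ℝ := fun x => deriv s x + 2 * p₁ x * s x with hG
  have hGc : Continuous G :=
    ((contDiff_infty_iff_deriv.1 hss).2.continuous).add
      ((continuous_const.mul hp₁s.continuous).mul hss.continuous)
  have hGp : Function.Periodic G 1 := fun x => by
    simp only [hG, hsp.deriv_one x, hp₁p x, hsp x]
  obtain ⟨Sc, hSc⟩ := exists_circle_lift (u := fun x => Complex.I * (s x : ℂ))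
    (continuous_const.mul (Complex.continuous_ofReal.comp hss.continuous))
    (fun x => by simp only [hsp x])
  obtain ⟨Gc, hGcc⟩ := exists_circle_lift (u := fun x => Complex.I * (G x : ℂ))
    (continuous_const.mul (Complex.continuous_ofReal.comp hGc))
    (fun x => by simp only [hGp x])
  obtain ⟨C, hC⟩ : ∃ C : ℝ, ∀ x y, q x / q y ≤ C := by
    obtain ⟨a, ha⟩ := (hqp.isBounded_of_continuous one_ne_zero hqc).bddAbove
    have hic : Continuous fun x => (q x)⁻¹ := hqc.inv₀ fun x => (hq0 x).ne'
    have hip : Function.Periodic (fun x => (q x)⁻¹) 1 := fun x => by simp only [hqp x]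
    obtain ⟨b, hb⟩ := (hip.isBounded_of_continuous one_ne_zero hic).bddAbove
    refine ⟨a * b, fun x y => ?_⟩
    rw [div_eq_mul_inv]
    have h1 : q x ≤ a := ha ⟨x, rfl⟩
    have h2 : (q y)⁻¹ ≤ b := hb ⟨y, rfl⟩
    exact mul_le_mul h1 h2 (inv_pos.2 (hq0 y)).le ((hq0 x).le.trans h1)
  have hC0 : 0 ≤ C := le_trans (by have := hq0 0; positivity) (hC 0 0)
  obtain ⟨D, h₀, hD, hh₀, hfix⟩ := exists_small_fixedPoint (2 * C) (by positivity) Gc Sc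
  refine ⟨‖Sc‖ + D, min h₀ 1, by positivity, by positivity, ?_⟩
  intro h hh hlt hres
  have hlt1 : h < 1 := hlt.trans_le (min_le_right _ _)
  have hhc : (h : ℂ) ≠ 0 := by exact_mod_cast hh.ne'
  set σ : ℝ → ℝ := fun x => ∫ t in (0 : ℝ)..x, q t with hσ
  have hσd : ∀ x, HasDerivAt σ (q x) x := fun x =>
    intervalIntegral.integral_hasDerivAt_right (hqc.intervalIntegrable 0 x)
      hqc.stronglyMeasurable.stronglyMeasurableAtFilter hqc.continuousAt
  have hσp : ∀ x, σ (x + 1) = σ x + ∫ t in (0 : ℝ)..1, q t := by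
    intro x
    simp only [hσ]
    rw [← intervalIntegral.integral_add_adjacent_intervals (hqc.intervalIntegrable 0 x)
        (hqc.intervalIntegrable x (x + 1)), hqp.intervalIntegral_add_eq x 0, zero_add]
  -- Here `|m| = 1/q` does not depend on `h`, and the resonance condition on `h` is exactly
  -- antiperiodicity of `m`.
  set m : ℝ → ℂ := fun x => Complex.exp (((2 * σ x / h : ℝ) : ℂ) * Complex.I) / (q x : ℂ) with hm
  have hqC : ∀ x, (q x : ℂ) ≠ 0 := fun x => by exact_mod_cast (hq0 x).ne'
  have hm0 : ∀ x, m x ≠ 0 := fun x => div_ne_zero (Complex.exp_ne_zero _) (hqC x)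
  have hmn : ∀ x, ‖m x‖ = (q x)⁻¹ := fun x => by
    rw [hm, norm_div, Complex.norm_exp_ofReal_mul_I, Complex.norm_real, norm_eq_abs,
      abs_of_pos (hq0 x), one_div]
  have hmC : ∀ x y, ‖(m x)⁻¹‖ * ‖m y‖ ≤ C := fun x y => by
    rw [norm_inv, hmn, hmn, inv_inv, ← div_eq_mul_inv]
    exact hC x y
  have hmanti : Function.Antiperiodic m 1 := fun x => by
    simp only [hm, hσp x, hqp x]
    rw [mul_add, add_div, Complex.ofReal_add, add_mul, Complex.exp_add, hres]
    ring
  set a : ℝ → ℂ := fun x => 2 * Complex.I * q x / h + 2 * p₁ x with ha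
  have hmd : ∀ x, HasDerivAt m (a x * m x) x := by
    intro x
    have h1 := (((((hσd x).const_mul 2).div_const h).ofReal_comp.mul_const Complex.I).cexp).div
      (hqd x).ofReal_comp (hqC x)
    refine h1.congr_deriv ?_
    simp only [ha, hm, hp₁]
    have := hqC x
    push_cast
    field_simp
    ring
  have hmc : Continuous m := continuous_iff_continuousAt.2 fun x => (hmd x).continuousAt
  obtain ⟨w, hwn, hw⟩ := hfix h hh (hlt.trans_le (min_le_left _ _))
    (circleSolve m hmc hmanti hm0) (norm_circleSolve_le hmc hmanti hm0 hmC)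
  set W : ℝ → ℂ := fun x => w x with hW
  have hWd : ∀ x, HasDerivAt W
      (-(h * (Complex.I * G x) + (h * (Complex.I * s x) + W x) ^ 2) - a x * W x) x := by
    intro x
    set g : C(UnitAddCircle, ℂ) := -(h • Gc + (h • Sc + w) ^ 2) with hg
    have hWe : W = antiperiodicSolve m (fun t : ℝ => g t) := by
      funext x
      rw [← circleSolve_apply_coe m hmc hmanti hm0, hw]
    have h1 := antiperiodicSolve_hasDerivAt hm0 hmd
      (g.continuous.comp (AddCircle.continuous_mk' 1)) x
    have h2 : HasDerivAt W ((fun t : ℝ => g t) x - a x * W x) x := by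
      rw [hWe]; exact h1
    refine h2.congr_deriv ?_
    simp only [hg, ContinuousMap.neg_apply, ContinuousMap.add_apply, ContinuousMap.smul_apply,
      ContinuousMap.pow_apply, hSc, hGcc, hW, Complex.real_smul]
  refine ⟨fun x => Complex.I * q x + h * p₁ x + h * (h * (Complex.I * s x) + W x), ?_, ?_, ?_⟩
  · intro x
    have : W (x + 1) = W x := by simp [hW]
    simp only [hqp x, hp₁p x, hsp x, this]
  · intro x
    have h1 := (((hqd x).ofReal_comp.const_mul Complex.I).add
      ((hp₁d x).ofReal_comp.const_mul (h : ℂ))).add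
      ((((hsd x).ofReal_comp.const_mul Complex.I).const_mul (h : ℂ)).add (hWd x)|>.const_mul (h : ℂ))
    refine h1.congr_deriv ?_
    have e1 : ((deriv q x : ℝ) : ℂ) = -(2 * q x * p₁ x) := by
      have := hqC x
      simp only [hp₁]; push_cast; field_simp
    have e2 : ((deriv p₁ x : ℝ) : ℂ) = 2 * q x * s x - p₁ x ^ 2 := by
      have := hqC x
      simp only [hs]; push_cast; field_simp; ring
    have e3 : (G x : ℂ) = ((deriv s x : ℝ) : ℂ) + 2 * p₁ x * s x := by simp only [hG]; push_cast; ring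
    rw [e1, e2, e3]
    simp only [ha]
    push_cast
    field_simp
    linear_combination (2 * h ^ 2 * s x * q x + q x ^ 2 : ℂ) * Complex.I_sq
  · intro x
    have e : (Complex.I * q x + h * p₁ x + h * (h * (Complex.I * s x) + W x)).im - q x
        = h * (h * (Complex.I * s x) + W x).im := by
      simp
    rw [e, abs_mul, abs_of_pos hh, mul_comm]
    refine mul_le_mul_of_nonneg_right ?_ hh.le
    refine (Complex.abs_im_le_norm _).trans ((norm_add_le _ _).trans (add_le_add ?_ ?_))
    · rw [← hSc, norm_mul, Complex.norm_real, norm_eq_abs, abs_of_pos hh]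
      exact (mul_le_of_le_one_left (norm_nonneg _) hlt1.le).trans (Sc.norm_coe_le_norm _)
    · refine (w.norm_coe_le_norm _).trans (hwn.trans ?_)
      exact mul_le_of_le_one_right hD.le hlt1.le

/-! ### Semiclassical states at fixed energy -/

/-- Semiclassical Bloch states above the maximum of the potential: the momentum is close to the
classical action and the density is controlled by the classical density. -/
theorem exists_semiclassical_blochEigenstate {V : ℝ → ℝ} (hV : ContDiff ℝ ∞ V)
    (hper : Function.Periodic V 1) {E : ℝ} (hE : ∀ x, V x < E) {ε : ℝ} (hε : 0 < ε) :
    ∃ h P ψ, 0 < h ∧ h < ε ∧ |P - ∫ x in (0 : ℝ)..1, √(E - V x)| < ε ∧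
      IsNormalizedBlochEigenstate V h P E ψ ∧
      ∀ x, ‖ψ x‖ ^ 2 ≤ 2 * ((√(E - V x))⁻¹ / ∫ t in (0 : ℝ)..1, (√(E - V t))⁻¹) := by
  set q : ℝ → ℝ := fun x => √(E - V x) with hq
  have hq0 : ∀ x, 0 < q x := fun x => sqrt_pos.2 (sub_pos.2 (hE x))
  have hqs : ContDiff ℝ ∞ q := (contDiff_const.sub hV).sqrt fun x => (sub_pos.2 (hE x)).ne'
  have hqc : Continuous q := hqs.continuous
  have hqp : Function.Periodic q 1 := fun x => by simp only [hq, hper x]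
  have hic : Continuous fun x => (q x)⁻¹ := hqc.inv₀ fun x => (hq0 x).ne'
  obtain ⟨b, hb⟩ : ∃ b, ∀ x, (q x)⁻¹ ≤ b := by
    have hip : Function.Periodic (fun x => (q x)⁻¹) 1 := fun x => by simp only [hqp x]
    obtain ⟨b, hb⟩ := (hip.isBounded_of_continuous one_ne_zero hic).bddAbove
    exact ⟨b, fun x => hb ⟨x, rfl⟩⟩
  have hb0 : 0 < b := (inv_pos.2 (hq0 0)).trans_le (hb 0)
  obtain ⟨M, h₀, hM, hh₀, hsol⟩ := exists_periodic_riccati hqs hqp hq0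
  set Λ : ℝ := ∫ x in (0 : ℝ)..1, q x with hΛ
  have hΛ0 : 0 < Λ :=
    intervalIntegral.intervalIntegral_pos_of_pos (hqc.intervalIntegrable _ _) hq0 one_pos
  -- The admissible values `h = 2Λ / (π + 2πn)` make the phase `2Λ/h` an odd multiple of `π`. The
  -- bound `ε / (2M)` controls `P`; since `q ≥ 1/b`, the bound `1 / (3bM)` gives `M h ≤ q/3`.
  obtain ⟨h, hh, hlt, hres⟩ : ∃ h : ℝ, 0 < h ∧
      h < min (min h₀ ε) (min (ε / (2 * M)) (1 / (3 * b * M))) ∧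
      Complex.exp (((2 * Λ / h : ℝ) : ℂ) * Complex.I) = -1 := by
    have ht : Tendsto (fun n : ℕ => 2 * Λ / (π + n * (2 * π))) atTop (𝓝 0) := by
      refine tendsto_const_nhds.div_atTop (tendsto_atTop_add_const_left _ _ ?_)
      exact tendsto_natCast_atTop_atTop.atTop_mul_const (by positivity)
    have hpos : 0 < min (min h₀ ε) (min (ε / (2 * M)) (1 / (3 * b * M))) := by positivity
    obtain ⟨n, hn⟩ := (ht.eventually (gt_mem_nhds hpos)).exists
    refine ⟨_, by positivity, hn, ?_⟩
    have : 2 * Λ / (2 * Λ / (π + n * (2 * π))) = π + n * (2 * π) := by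
      have : 0 < π + n * (2 * π) := by positivity
      field_simp
    rw [this]
    push_cast
    rw [add_mul, Complex.exp_add, Complex.exp_pi_mul_I, mul_assoc, Complex.exp_nat_mul_two_pi_mul_I]
    ring
  simp only [lt_min_iff] at hlt
  obtain ⟨⟨hlt0, hltε⟩, hlt1, hlt2⟩ := hlt
  obtain ⟨p, hpp, hpd, hpb⟩ := hsol h hh hlt0 hres
  have hMh : M * h < ε := by
    rw [lt_div_iff₀ (by positivity)] at hlt1
    nlinarith
  have hMh' : ∀ x, M * h ≤ q x / 3 := by
    intro x
    rw [lt_div_iff₀ (by positivity)] at hlt2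
    have h1 : 1 ≤ q x * b := by
      have := mul_le_mul_of_nonneg_left (hb x) (hq0 x).le
      rwa [mul_inv_cancel₀ (hq0 x).ne'] at this
    have h2 : b * (3 * (M * h)) ≤ b * q x := by nlinarith
    have := le_of_mul_le_mul_left h2 hb0
    linarith
  have hlow : ∀ x, 2 / 3 * q x ≤ (p x).im := fun x => by
    have := (abs_le.1 ((hpb x).trans (hMh' x))).1; linarith
  have hupp : ∀ x, (p x).im ≤ 4 / 3 * q x := fun x => by
    have := (abs_le.1 ((hpb x).trans (hMh' x))).2; linarith
  have hpos : ∀ x, 0 < (p x).im := fun x => lt_of_lt_of_le (by have := hq0 x; positivity) (hlow x)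
  have hpc : Continuous p := continuous_iff_continuousAt.2 fun x => (hpd x).continuousAt
  have hyc : Continuous fun x => (p x).im := Complex.continuous_im.comp hpc
  obtain ⟨ψ, hψ, hψn⟩ := exists_blochEigenstate_of_riccati (V := V) (E := E) hh hV.continuous hpp
    hpos (fun x => by
      have := hpd x
      simp only [hq, sq_sqrt (sub_pos.2 (hE x)).le] at this
      exact this)
  refine ⟨h, _, ψ, hh, hltε, ?_, hψ, ?_⟩
  · rw [← intervalIntegral.integral_sub (hyc.intervalIntegrable _ _) (hqc.intervalIntegrable _ _)]
    refine lt_of_le_of_lt ?_ hMh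
    have := intervalIntegral.norm_integral_le_of_norm_le_const
      (a := 0) (b := 1) (f := fun x => (p x).im - q x) (C := M * h) fun x _ => hpb x
    simpa using this
  · intro x
    rw [hψn]
    have hyi : Continuous fun x => ((p x).im)⁻¹ := hyc.inv₀ fun x => (hpos x).ne'
    have hZ : 0 < ∫ t in (0 : ℝ)..1, (q t)⁻¹ :=
      intervalIntegral.intervalIntegral_pos_of_pos (hic.intervalIntegrable _ _)
        (fun x => inv_pos.2 (hq0 x)) one_pos
    have h1 : ((p x).im)⁻¹ ≤ 3 / 2 * (q x)⁻¹ := by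
      have := inv_anti₀ (by have := hq0 x; positivity) (hlow x)
      rwa [mul_inv, inv_div] at this
    have h2 : 3 / 4 * (∫ t in (0 : ℝ)..1, (q t)⁻¹) ≤ ∫ t in (0 : ℝ)..1, ((p t).im)⁻¹ := by
      rw [← intervalIntegral.integral_const_mul]
      refine intervalIntegral.integral_mono_on zero_le_one
        ((continuous_const.mul hic).intervalIntegrable _ _) (hyi.intervalIntegrable _ _) ?_
      intro t _
      have := inv_anti₀ (hpos t) (hupp t)
      rwa [mul_inv, inv_div] at this
    -- From `2q/3 ≤ Im p ≤ 4q/3`, the factor is `(3/2) / (3/4) = 2`.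
    calc ((p x).im)⁻¹ / ∫ t in (0 : ℝ)..1, ((p t).im)⁻¹
        ≤ (3 / 2 * (q x)⁻¹) / (3 / 4 * ∫ t in (0 : ℝ)..1, (q t)⁻¹) :=
          div_le_div₀ (by have := hq0 x; positivity) h1 (by positivity) h2
      _ = 2 * ((q x)⁻¹ / ∫ t in (0 : ℝ)..1, (q t)⁻¹) := by
          field_simp; norm_num

/-! ### Concentration as the energy reaches the maximum -/

theorem le_potentialMax {V : ℝ → ℝ} (hV : Continuous V) (hper : Function.Periodic V 1) (x : ℝ) :
    V x ≤ potentialMax V :=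
  le_ciSup (hper.isBounded_of_continuous one_ne_zero hV).bddAbove x

/-- If the classical density at the maximum is not integrable, its normalization constants blow up
as the energy decreases to the maximum. -/
theorem tendsto_integral_inv_sqrt_atTop {V : ℝ → ℝ} (hV : Continuous V)
    (hper : Function.Periodic V 1)
    (hdiv : ∫⁻ x in Set.Icc (0 : ℝ) 1,
      (ENNReal.ofReal (potentialMax V - V x)) ^ (-(1 / 2) : ℝ) = ⊤)
    {E : ℕ → ℝ} (hE : ∀ k, potentialMax V < E k) (hlim : Tendsto E atTop (𝓝 (potentialMax V))) :
    Tendsto (fun k => ∫ x in (0 : ℝ)..1, (√(E k - V x))⁻¹) atTop atTop := by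
  have hlt : ∀ k x, 0 < E k - V x := fun k x =>
    sub_pos.2 ((le_potentialMax hV hper x).trans_lt (hE k))
  set F : ℕ → ℝ → ENNReal := fun k x => (ENNReal.ofReal (E k - V x)) ^ (-(1 / 2) : ℝ) with hF
  have hFm : ∀ k, Measurable (F k) := fun k =>
    ((measurable_const.sub hV.measurable).ennreal_ofReal).pow_const _
  -- Extended values give convergence at every point, including maximum points of `V`, where the
  -- limit is `⊤`.
  have hFlim : ∀ x, Tendsto (fun k => F k x) atTop
      (𝓝 ((ENNReal.ofReal (potentialMax V - V x)) ^ (-(1 / 2) : ℝ))) := fun x =>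
    ((ENNReal.continuous_rpow_const.comp ENNReal.continuous_ofReal).tendsto _).comp
      (hlim.sub_const (V x))
  have hfatou := lintegral_liminf_le (u := atTop) (μ := volume.restrict (Icc (0 : ℝ) 1)) hFm
  simp only [(hFlim _).liminf_eq, hdiv] at hfatou
  have htop : Tendsto (fun k => ∫⁻ x in Icc (0 : ℝ) 1, F k x) atTop (𝓝 ⊤) :=
    tendsto_of_le_liminf_of_limsup_le hfatou le_top
  have heq : ∀ k, ∫⁻ x in Icc (0 : ℝ) 1, F k x
      = ENNReal.ofReal (∫ x in (0 : ℝ)..1, (√(E k - V x))⁻¹) := by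
    intro k
    have hc : Continuous fun x => (√(E k - V x))⁻¹ :=
      (continuous_const.sub hV).sqrt.inv₀ fun x => (sqrt_pos.2 (hlt k x)).ne'
    rw [intervalIntegral.integral_of_le zero_le_one, ← integral_Icc_eq_integral_Ioc,
      ofReal_integral_eq_lintegral_ofReal (hc.integrableOn_Icc)
        (ae_of_all _ fun x => inv_nonneg.2 (sqrt_nonneg _))]
    refine lintegral_congr fun x => ?_
    simp only [hF]
    rw [ENNReal.ofReal_rpow_of_pos (hlt k x), rpow_neg (hlt k x).le, sqrt_eq_rpow]
  simp only [heq] at htop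
  refine tendsto_atTop.2 fun b => ?_
  have := htop.eventually (lt_mem_nhds (ENNReal.ofReal_lt_top (r := b)))
  filter_upwards [this] with k hk
  exact (ENNReal.ofReal_lt_ofReal_iff'.1 hk).1.le

/-- A periodic continuous function deviates from its value at the unique maximum point of `V` by at
most a multiple of `max V - V`, up to `ε`. -/
theorem exists_abs_sub_le_mul {V f : ℝ → ℝ} (hV : Continuous V) (hper : Function.Periodic V 1)
    {x₀ : ℝ} (huniq : ∀ x ∈ Set.Ico (0 : ℝ) 1, V x = potentialMax V → x = x₀)
    (hf : Continuous f) (hfp : Function.Periodic f 1) {ε : ℝ} (hε : 0 < ε) :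
    ∃ C, 0 ≤ C ∧ ∀ x, |f x - f x₀| ≤ ε + C * (potentialMax V - V x) := by
  have hle := le_potentialMax hV hper
  have hgc : Continuous fun x => |f x - f x₀| := (hf.sub continuous_const).abs
  obtain ⟨B, hB⟩ : ∃ B, ∀ x, |f x - f x₀| ≤ B := by
    have hgp : Function.Periodic (fun x => |f x - f x₀|) 1 := fun x => by simp only [hfp x]
    obtain ⟨b, hb⟩ := (hgp.isBounded_of_continuous one_ne_zero hgc).bddAbove
    exact ⟨b, fun x => hb ⟨x, rfl⟩⟩
  have hB0 : 0 ≤ B := (abs_nonneg _).trans (hB 0)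
  set K : Set ℝ := Icc 0 1 ∩ {x | ε ≤ |f x - f x₀|} with hK
  have hKc : IsCompact K := isCompact_Icc.inter_right (isClosed_le continuous_const hgc)
  have hpos : ∀ x ∈ K, V x < potentialMax V := by
    rintro x ⟨hx, hxε⟩
    refine lt_of_le_of_ne (hle x) fun hVx => ?_
    have hfx : f x = f x₀ := by
      rcases hx.2.lt_or_eq with h1 | rfl
      · rw [huniq x ⟨hx.1, h1⟩ hVx]
      -- Uniqueness is assumed on `[0,1)`, whereas the compact set may contain `1`; periodicity
      -- folds that endpoint back to `0`.
      · have e1 := hper 0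
        have e2 := hfp 0
        rw [zero_add] at e1 e2
        rw [e2, huniq 0 (by simp) (by rw [← e1, hVx])]
    simp only [mem_ofPred_eq, hfx, sub_self, abs_zero] at hxε
    linarith
  obtain ⟨c, hc, hcK⟩ : ∃ c, 0 < c ∧ ∀ x ∈ K, c ≤ potentialMax V - V x := by
    rcases K.eq_empty_or_nonempty with h0 | h0
    · exact ⟨1, one_pos, by simp [h0]⟩
    · obtain ⟨y, hy, hmin⟩ := hKc.exists_isMinOn h0
        (continuous_const.sub hV : Continuous fun x => potentialMax V - V x).continuousOn
      exact ⟨_, sub_pos.2 (hpos y hy), fun x hx => hmin hx⟩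
  have hC : 0 ≤ B / c := by positivity
  refine ⟨B / c, hC, fun x => ?_⟩
  obtain ⟨y, hy, hxy⟩ : ∃ y ∈ Icc (0 : ℝ) 1, f x = f y ∧ V x = V y := by
    refine ⟨Int.fract x, ⟨Int.fract_nonneg x, (Int.fract_lt_one x).le⟩, ?_, ?_⟩
    · have := hfp.sub_int_mul_eq (x := x) ⌊x⌋
      rw [mul_one] at this; exact this.symm
    · have := hper.sub_int_mul_eq (x := x) ⌊x⌋
      rw [mul_one] at this; exact this.symm
  rw [hxy.1, hxy.2]
  by_cases h : ε ≤ |f y - f x₀|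
  · have h1 := mul_le_mul_of_nonneg_left (hcK y ⟨hy, h⟩) hC
    rw [div_mul_cancel₀ _ hc.ne'] at h1
    linarith [hB y]
  · have := mul_nonneg hC (sub_nonneg.2 (hle y))
    linarith

/-- Densities dominated by classical densities with energy decreasing to the maximum concentrate. -/
theorem tendstoDirac_of_le_classical {V : ℝ → ℝ} (hV : Continuous V)
    (hper : Function.Periodic V 1) {x₀ : ℝ}
    (huniq : ∀ x ∈ Set.Ico (0 : ℝ) 1, V x = potentialMax V → x = x₀)
    (hdiv : ∫⁻ x in Set.Icc (0 : ℝ) 1,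
      (ENNReal.ofReal (potentialMax V - V x)) ^ (-(1 / 2) : ℝ) = ⊤)
    {E : ℕ → ℝ} (hE : ∀ k, potentialMax V < E k) (hlim : Tendsto E atTop (𝓝 (potentialMax V)))
    {J : ℝ} (hJ : ∀ k, ∫ x in (0 : ℝ)..1, √(E k - V x) ≤ J)
    {ρ : ℕ → ℝ → ℝ} (hρc : ∀ k, Continuous (ρ k)) (hρ0 : ∀ k x, 0 ≤ ρ k x)
    (hρ1 : ∀ k, ∫ x in (0 : ℝ)..1, ρ k x = 1)
    (hρ : ∀ k x, ρ k x ≤ 2 * ((√(E k - V x))⁻¹ / ∫ t in (0 : ℝ)..1, (√(E k - V t))⁻¹)) :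
    TendstoDirac ρ x₀ := by
  intro f hf hfp
  have hfc := hf.continuous
  have hZ := tendsto_integral_inv_sqrt_atTop hV hper hdiv hE hlim
  have hlt : ∀ k x, 0 < E k - V x := fun k x =>
    sub_pos.2 ((le_potentialMax hV hper x).trans_lt (hE k))
  rw [Metric.tendsto_atTop']
  intro ε hε
  obtain ⟨C, hC, hCf⟩ := exists_abs_sub_le_mul hV hper huniq hfc hfp (half_pos hε)
  obtain ⟨N, hN⟩ := (hZ.eventually_gt_atTop (max 0 (4 * C * J / ε))).exists_forall_of_atTop
  refine ⟨N, fun k hk => ?_⟩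
  obtain ⟨hZ0, hZJ⟩ := max_lt_iff.1 (hN k hk.le)
  set Z : ℝ := ∫ t in (0 : ℝ)..1, (√(E k - V t))⁻¹ with hZdef
  have hqc : Continuous fun x => √(E k - V x) := (continuous_const.sub hV).sqrt
  have e : (∫ x in (0 : ℝ)..1, f x * ρ k x) - f x₀ = ∫ x in (0 : ℝ)..1, (f x - f x₀) * ρ k x := by
    have hi1 : IntervalIntegrable (fun x => f x * ρ k x) volume 0 1 :=
      (hfc.mul (hρc k)).intervalIntegrable _ _
    have hi2 : IntervalIntegrable (fun x => f x₀ * ρ k x) volume 0 1 :=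
      (continuous_const.mul (hρc k)).intervalIntegrable _ _
    simp only [sub_mul]
    rw [intervalIntegral.integral_sub hi1 hi2,
      intervalIntegral.integral_const_mul, hρ1, mul_one]
  -- As `max V - V ≤ q²`, the quadratic weight absorbs the singular `q⁻¹` and leaves `q`, whose
  -- integral is at most `J`. The threshold `4CJ/ε` on `Z` makes this term smaller than `ε/2`.
  have hpt : ∀ x, |(f x - f x₀) * ρ k x| ≤ ε / 2 * ρ k x + 2 * C / Z * √(E k - V x) := by
    intro x
    have hs := sqrt_pos.2 (hlt k x)
    have h1 : C * (potentialMax V - V x) ≤ C * (√(E k - V x) * √(E k - V x)) := by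
      rw [mul_self_sqrt (hlt k x).le]
      exact mul_le_mul_of_nonneg_left (by linarith [hE k]) hC
    rw [abs_mul, abs_of_nonneg (hρ0 k x)]
    calc |f x - f x₀| * ρ k x
        ≤ (ε / 2 + C * (√(E k - V x) * √(E k - V x))) * ρ k x :=
          mul_le_mul_of_nonneg_right ((hCf x).trans (by linarith)) (hρ0 k x)
      _ = ε / 2 * ρ k x + C * (√(E k - V x) * √(E k - V x)) * ρ k x := by ring
      _ ≤ ε / 2 * ρ k x + C * (√(E k - V x) * √(E k - V x)) * (2 * ((√(E k - V x))⁻¹ / Z)) := by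
          gcongr
          exact hρ k x
      _ = ε / 2 * ρ k x + 2 * C / Z * √(E k - V x) := by field_simp
  rw [dist_eq_norm, e]
  have hi1 : IntervalIntegrable (fun x => ε / 2 * ρ k x) volume 0 1 :=
    (continuous_const.mul (hρc k)).intervalIntegrable _ _
  have hi2 : IntervalIntegrable (fun x => 2 * C / Z * √(E k - V x)) volume 0 1 :=
    (continuous_const.mul hqc).intervalIntegrable _ _
  calc ‖∫ x in (0 : ℝ)..1, (f x - f x₀) * ρ k x‖
      ≤ ∫ x in (0 : ℝ)..1, (ε / 2 * ρ k x + 2 * C / Z * √(E k - V x)) :=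
        intervalIntegral.norm_integral_le_of_norm_le zero_le_one
          (ae_of_all _ fun x _ => hpt x) (hi1.add hi2)
    _ = ε / 2 + 2 * C / Z * ∫ x in (0 : ℝ)..1, √(E k - V x) := by
        rw [intervalIntegral.integral_add hi1 hi2, intervalIntegral.integral_const_mul,
          intervalIntegral.integral_const_mul, hρ1, mul_one]
    _ ≤ ε / 2 + 2 * C / Z * J := by
        gcongr
        exact hJ k
    _ < ε := by
        rw [div_lt_iff₀ hε] at hZJ
        have : 2 * C / Z * J < ε / 2 := by
          rw [div_mul_eq_mul_div, div_lt_iff₀ hZ0]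
          linarith
        linarith

/-! ### Choice of energies and gauges -/

/-- Opens gaps between the actions at successive energies, inside which the approximate gauges can
be placed so that they still decrease strictly. -/
theorem action_strictMonoOn {V : ℝ → ℝ} (hV : Continuous V) (hper : Function.Periodic V 1)
    {E E' : ℝ} (hE : potentialMax V ≤ E) (hEE' : E < E') :
    ∫ x in (0 : ℝ)..1, √(E - V x) < ∫ x in (0 : ℝ)..1, √(E' - V x) := by
  have hc : ∀ E : ℝ, Continuous fun x => √(E - V x) := fun E => (continuous_const.sub hV).sqrt
  rw [← sub_pos, ← intervalIntegral.integral_sub ((hc E').intervalIntegrable _ _)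
    ((hc E).intervalIntegrable _ _)]
  refine intervalIntegral.intervalIntegral_pos_of_pos
    (((hc E').sub (hc E)).intervalIntegrable _ _) (fun x => sub_pos.2 ?_) one_pos
  exact sqrt_lt_sqrt (sub_nonneg.2 ((le_potentialMax hV hper x).trans hE)) (by linarith)

theorem continuous_action {V : ℝ → ℝ} (hV : Continuous V) :
    Continuous fun E => ∫ x in (0 : ℝ)..1, √(E - V x) := by
  refine intervalIntegral.continuous_parametric_intervalIntegral_of_continuous' ?_ 0 1
  exact (continuous_fst.sub (hV.comp continuous_snd)).sqrt

theorem mainTheorem3 (V : ℝ → ℝ) (hV : ContDiff ℝ ∞ V) (hper : Function.Periodic V 1)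
    (x₀ : ℝ) (hx₀ : x₀ ∈ Set.Ico (0 : ℝ) 1) (hmax : V x₀ = potentialMax V)
    (huniq : ∀ x ∈ Set.Ico (0 : ℝ) 1, V x = potentialMax V → x = x₀)
    (hdiv : ∫⁻ x in Set.Icc (0 : ℝ) 1,
      (ENNReal.ofReal (potentialMax V - V x)) ^ (-(1 / 2) : ℝ) = ⊤) :
    ∃ (P E h : ℕ → ℝ) (ψ : ℕ → ℝ → ℂ),
      DecreasesTo P (criticalGauge V) ∧
      DecreasesTo E (potentialMax V) ∧
      (∀ k, 0 < h k) ∧ Tendsto h atTop (𝓝 0) ∧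
      (∀ k, IsNormalizedBlochEigenstate V (h k) (P k) (E k) (ψ k)) ∧
      TendstoDirac (fun k x => ‖ψ k x‖ ^ 2) x₀ := by
  have hVc := hV.continuous
  set J : ℝ → ℝ := fun E => ∫ x in (0 : ℝ)..1, √(E - V x) with hJ
  have hJm : ∀ {s t : ℝ}, 0 ≤ s → s < t → J (potentialMax V + s) < J (potentialMax V + t) :=
    fun hs hst => action_strictMonoOn hVc hper (by linarith) (by linarith)
  set e : ℕ → ℝ := fun k => 1 / ((k : ℝ) + 1) with he
  have he0 : ∀ k, 0 < e k := fun k => by simp only [he]; positivity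
  have hea : StrictAnti e := strictAnti_nat_of_succ_lt fun k => by
    simp only [he]; push_cast
    exact one_div_lt_one_div_of_lt (by positivity) (by linarith)
  have helim : Tendsto e atTop (𝓝 0) := tendsto_one_div_add_atTop_nhds_zero_nat
  set u : ℕ → ℝ := fun k => J (potentialMax V + e k) with hu
  have hulim : Tendsto u atTop (𝓝 (criticalGauge V)) := by
    have h1 := ((continuous_action hVc).tendsto (potentialMax V)).comp
      (by simpa using helim.const_add (potentialMax V))
    exact h1
  have hua : StrictAnti u := fun i j hij => hJm (he0 j).le (hea hij)
  have hu0 : ∀ k, criticalGauge V < u k := fun k => by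
    have := hJm le_rfl (he0 k)
    rwa [add_zero] at this
  -- the energies are `max V + e (k + 1)`, the momenta lie between the midpoints of successive `u`
  set δ : ℕ → ℝ := fun k =>
    min (e k) (min ((u k - u (k + 1)) / 2) ((u (k + 1) - u (k + 2)) / 2)) with hδ
  have hδ0 : ∀ k, 0 < δ k := fun k => by
    have h1 := hua (Nat.lt_succ_self k)
    have h2 := hua (Nat.lt_succ_self (k + 1))
    simp only [Nat.succ_eq_add_one] at h1 h2
    exact lt_min (he0 k) (lt_min (by linarith) (by linarith))
  have hElt : ∀ k x, V x < potentialMax V + e (k + 1) := fun k x => by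
    have := le_potentialMax hVc hper x
    linarith [he0 (k + 1)]
  choose h P ψ hh hhδ hP hψ hρ using fun k =>
    exists_semiclassical_blochEigenstate hV hper (hElt k) (hδ0 k)
  have hP' : ∀ k, |P k - u (k + 1)| < δ k := hP
  have hPl : ∀ k, P k < u (k + 1) + (u k - u (k + 1)) / 2 := fun k => by
    have h1 := (abs_lt.1 (hP' k)).2
    have h2 : δ k ≤ (u k - u (k + 1)) / 2 := (min_le_right _ _).trans (min_le_left _ _)
    linarith
  have hPg : ∀ k, u (k + 1) - (u (k + 1) - u (k + 2)) / 2 < P k := fun k => by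
    have h1 := (abs_lt.1 (hP' k)).1
    have h2 : δ k ≤ (u (k + 1) - u (k + 2)) / 2 := (min_le_right _ _).trans (min_le_right _ _)
    linarith
  have hshift : ∀ {v : ℕ → ℝ} {a : ℝ}, Tendsto v atTop (𝓝 a) →
      Tendsto (fun k => v (k + 1)) atTop (𝓝 a) := fun h => h.comp (tendsto_add_atTop_nat 1)
  have hElim : Tendsto (fun k => potentialMax V + e (k + 1)) atTop (𝓝 (potentialMax V)) := by
    simpa using (hshift helim).const_add (potentialMax V)
  refine ⟨P, fun k => potentialMax V + e (k + 1), h, ψ, ⟨?_, ?_⟩, ⟨?_, hElim⟩, hh, ?_, hψ, ?_⟩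
  · refine strictAnti_nat_of_succ_lt fun k => ?_
    have h1 := hPl (k + 1)
    have h2 := hPg k
    simp only [add_assoc, Nat.reduceAdd] at h1
    linarith
  · refine tendsto_of_tendsto_of_tendsto_of_le_of_le
      (hshift (hshift hulim)) hulim (fun k => ?_) (fun k => ?_)
    · have h1 := hPg k
      have h2 := hua (Nat.lt_succ_self (k + 1))
      simp only [Nat.succ_eq_add_one, add_assoc, Nat.reduceAdd] at h1 h2 ⊢
      linarith
    · have h1 := hPl k
      have h2 := hua (Nat.lt_succ_self k)
      simp only [Nat.succ_eq_add_one] at h2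
      linarith
  · intro i j hij
    have := hea (Nat.add_lt_add_right hij 1)
    simpa using this
  · exact tendsto_of_tendsto_of_tendsto_of_le_of_le tendsto_const_nhds helim
      (fun k => (hh k).le) fun k => (hhδ k).le.trans (min_le_left _ _)
  -- The actions decrease in `k`, so `u 0` bounds them all.
  · refine tendstoDirac_of_le_classical hVc hper huniq hdiv
      (fun k => by linarith [he0 (k + 1)]) hElim (J := u 0)
      (fun k => hua.antitone (Nat.zero_le (k + 1)))
      (fun k => ((hψ k).eigenstate.contDiff.continuous.norm.pow 2)) (fun k x => by positivity)
      (fun k => (hψ k).normalized) hρ
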